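/- Let $\mathbb{Q}(t)$ be the field of rational functions over $\mathbb{Q}$, let $T$ be the complete first-order theory of $(\mathbb{R},<,+,0,1)$, and let $\mathcal{L}_t$ be the language $\{<,+,0,1\}\cup\{\lambda_q : q\in\mathbb{Q}(t)\}$, where each $\lambda_q$ is a unary function symbol. Let $T_t$ be the $\mathcal{L}_t$-theory which extends $T$ by first-order axioms stating, for a structure $\mathcal{M}=(M,<,+,0,1,(\lambda_q)_{q\in\mathbb{Q}(t)})$: (T1) $(M,+,0,(\lambda_q)_{q\in\mathbb{Q}(t)})$ is a $\mathbb{Q}(t)$-vector space, with $\lambda_q$ as scalar multiplication by $q$; (T2) whenever $q_1,\dots,q_m\in\mathbb{Q}(t)$ are linearly independent over $\mathbb{Q}$, the image of $M\to M^m$, $x\mapsto(\lambda_{q_1}(x),\dots,\lambda_{q_m}(x))$, is dense in $M^m$ (for the product of the order topology). For $S\subseteq M$, let $\operatorname{dcl}(S)$ denote the definable closure of $S$ in $\mathcal{M}$, that is, the set of all $a\in M$ such that $\{a\}$ is $\mathcal{L}_t$-definable with parameters from $S$. **Proposition.** Every model $\mathcal{M}$ of $T_t$ has the exchange property: for all $S\subseteq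 M$ and $a,b\in M$, if $a\in\operatorname{dcl}(S\cup\{b\})\setminus\operatorname{dcl}(S)$, then $b\in\operatorname{dcl}(S\cup\{a\})$. Moreover, for every $Z\subseteq M$, $\operatorname{dcl}(Z)$ is the $\mathbb{Q}(t)$-linear span of $Z\cup\{1\}$, and every $\mathcal{L}_t$-substructure $\mathcal{A}$ of $\mathcal{M}$ is definably closed, i.e. $\operatorname{dcl}(A)=A$. -/

import Mathlib

open FirstOrder

namespace RatVS

open FirstOrder.Language

/-! ### Definable closure and the exchange property -/

/-- The definable closure of `S` in `M`: the elements `a` such that `{a}` is `L`-definable with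
parameters from `S`. -/
def dcl (L : Language) {M : Type*} [L.Structure M] (S : Set M) : Set M :=
  {a | S.Definable₁ L {a}}

/-- The exchange property of an `L`-structure `M`. -/
def HasExchange (L : Language) (M : Type*) [L.Structure M] : Prop :=
  ∀ (S : Set M) (a b : M), a ∈ dcl L (S ∪ {b}) \ dcl L S → b ∈ dcl L (S ∪ {a})

/-! ### The language `(<, +, 0, 1)` and the theory of the ordered additive group of the reals -/

/-- The function symbols `+, 0, 1`. -/
inductive BaseFunc : ℕ → Type
  | plus : BaseFunc 2
  | zero : BaseFunc 0
  | one : BaseFunc 0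

/-- The only relation symbol is the binary symbol `<`. -/
inductive OrdRel : ℕ → Type
  | lt : OrdRel 2

/-- The language of `(ℝ, <, +, 0, 1)`. -/
def Lbase : Language := ⟨BaseFunc, OrdRel⟩

/-- The structure `(ℝ, <, +, 0, 1)`. -/
noncomputable instance realStructure : Lbase.Structure ℝ where
  funMap {_} f := match f with
    | .plus => fun v => v 0 + v 1
    | .zero => fun _ => 0
    | .one => fun _ => 1
  RelMap {_} r := match r with
    | .lt => fun v => v 0 < v 1

/-- The complete first-order theory of `(ℝ, <, +, 0, 1)`. -/
def Tbase : Lbase.Theory := Lbase.completeTheory ℝ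

/-! ### The language with scalar multiplications by `ℚ(t)` -/

/-- The function symbols `+, 0, 1` and a unary symbol `scal q` for each `q ∈ ℚ(t)`. -/
inductive VSFunc : ℕ → Type
  | plus : VSFunc 2
  | zero : VSFunc 0
  | one : VSFunc 0
  | scal (q : RatFunc ℚ) : VSFunc 1

/-- The language `(<, +, 0, 1, (λ_q)_{q ∈ ℚ(t)})`. -/
def Lt : Language := ⟨VSFunc, OrdRel⟩

/-- The inclusion of the language `(<, +, 0, 1)` into `Lt`. -/
def baseHom : Lbase →ᴸ Lt where
  onFunction {_} f := match f with
    | .plus => VSFunc.plus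
    | .zero => VSFunc.zero
    | .one => VSFunc.one
  onRelation {_} r := r

/-- The function symbol `+` of `Lt`. -/
abbrev plusS : Lt.Functions 2 := VSFunc.plus

/-- The constant symbol `0` of `Lt`. -/
abbrev zeroS : Lt.Constants := VSFunc.zero

/-- The constant symbol `1` of `Lt`. -/
abbrev oneS : Lt.Constants := VSFunc.one

/-- The unary function symbol `λ_q` of `Lt`. -/
abbrev scalS (q : RatFunc ℚ) : Lt.Functions 1 := VSFunc.scal q

/-- The relation symbol `<` of `Lt`. -/
abbrev ltS : Lt.Relations 2 := OrdRel.lt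

section Interpretations

variable (M : Type*) [Lt.Structure M]

/-- The interpretation of `+`. -/
def plusM (x y : M) : M := Structure.funMap plusS ![x, y]

/-- The interpretation of `0`. -/
def zeroM : M := (zeroS : M)

/-- The interpretation of the constant symbol `1`. -/
def oneM : M := (oneS : M)

/-- The interpretation of `λ_q`. -/
def scalM (q : RatFunc ℚ) (x : M) : M := Structure.funMap (scalS q) ![x]

/-- The interpretation of `<`. -/
def ltM (x y : M) : Prop := Structure.RelMap ltS ![x, y]

end Interpretations

section Terms

variable {α : Type*}

/-- The term `s + u`. -/
def plusT (s u : Lt.Term α) : Lt.Term α := plusS.apply₂ s u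

/-- The term `0`. -/
def zeroT : Lt.Term α := zeroS.term

/-- The term `λ_q(s)`. -/
def scalT (q : RatFunc ℚ) (s : Lt.Term α) : Lt.Term α :=
  (scalS q).apply₁ s

/-- The formula `s < u`. -/
def ltF (s u : Lt.Term α) : Lt.Formula α := ltS.formula₂ s u

variable {M : Type*} [Lt.Structure M] (v : α → M)

@[simp]
theorem realize_plusT (s u : Lt.Term α) :
    (plusT s u).realize v = plusM M (s.realize v) (u.realize v) := by
  simp [plusT, plusM]

@[simp]
theorem realize_zeroT : (zeroT : Lt.Term α).realize v = zeroM M := by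
  simp [zeroT, zeroM]

@[simp]
theorem realize_scalT (q : RatFunc ℚ) (s : Lt.Term α) :
    (scalT q s).realize v = scalM M q (s.realize v) := by
  simp [scalT, scalM]

@[simp]
theorem realize_ltF (s u : Lt.Term α) :
    (ltF s u).Realize v ↔ ltM M (s.realize v) (u.realize v) := by
  simp [ltF, ltM]

end Terms

/-! ### The axioms -/

/-- Names for the axioms of `ℚ(t)`-vector spaces. -/
inductive VSAxiom : Type
  | plusAssoc
  | plusComm
  | zeroPlus
  | existsNeg
  | scalPlus (q : RatFunc ℚ)
  | plusScal (q r : RatFunc ℚ)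
  | mulScal (q r : RatFunc ℚ)
  | oneScal

/-- The sentences expressing that `(M, +, 0, (λ_q)_q)` is a `ℚ(t)`-vector space. -/
noncomputable def VSAxiom.toSentence : VSAxiom → Lt.Sentence
  | .plusAssoc => ∀' ∀' ∀' ((plusT (plusT (&0) (&1)) (&2)) =' (plusT (&0) (plusT (&1) (&2))))
  | .plusComm => ∀' ∀' ((plusT (&0) (&1)) =' (plusT (&1) (&0)))
  | .zeroPlus => ∀' ((plusT zeroT (&0)) =' (&0))
  | .existsNeg => ∀' ∃' ((plusT (&1) (&0)) =' zeroT)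
  | .scalPlus q => ∀' ∀' ((scalT q (plusT (&0) (&1))) =' (plusT (scalT q (&0)) (scalT q (&1))))
  | .plusScal q r => ∀' ((scalT (q + r) (&0)) =' (plusT (scalT q (&0)) (scalT r (&0))))
  | .mulScal q r => ∀' ((scalT (q * r) (&0)) =' (scalT q (scalT r (&0))))
  | .oneScal => ∀' ((scalT 1 (&0)) =' (&0))

/-- The sentence expressing that the image of `x ↦ (λ_{q₁}(x), …, λ_{qₘ}(x))` is dense in `M ^ m`:
whenever `aᵢ < bᵢ` for all `i`, there is `x` with `aᵢ < λ_{qᵢ}(x) < bᵢ` for all `i`.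
The variables `Sum.inl i` and `Sum.inr i` stand for `aᵢ` and `bᵢ`, and `()` stands for `x`. -/
noncomputable def denseSentence {m : ℕ} (q : Fin m → RatFunc ℚ) : Lt.Sentence :=
  Formula.iAlls (α := Empty) (Fin m ⊕ Fin m)
    ((Formula.iInf fun i : Fin m =>
        ltF (Term.var (Sum.inr (Sum.inl i))) (Term.var (Sum.inr (Sum.inr i)))) ⟹
      Formula.iExs Unit (Formula.iInf fun i : Fin m =>
        ltF (Term.var (Sum.inl (Sum.inr (Sum.inl i)))) (scalT (q i) (Term.var (Sum.inr ()))) ⊓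
        ltF (scalT (q i) (Term.var (Sum.inr ()))) (Term.var (Sum.inl (Sum.inr (Sum.inr i))))))

/-- The theory `T_t`: the theory of `(ℝ, <, +, 0, 1)`, the axioms of `ℚ(t)`-vector spaces, and for
each `ℚ`-linearly independent tuple `q` of `ℚ(t)` the density of the image of `λ_q`. -/
def Tt : Lt.Theory :=
  baseHom.onTheory Tbase ∪ Set.range VSAxiom.toSentence ∪
    {φ | ∃ (m : ℕ) (q : Fin m → RatFunc ℚ), LinearIndependent ℚ q ∧ φ = denseSentence q}

/-! ### The `ℚ(t)`-vector space underlying a model -/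

section Model

variable (M : Type*) [Lt.Structure M]

/-- What each vector space axiom says about `M`. -/
def VSAxiom.toProp : VSAxiom → Prop
  | .plusAssoc => ∀ x y z : M, plusM M (plusM M x y) z = plusM M x (plusM M y z)
  | .plusComm => ∀ x y : M, plusM M x y = plusM M y x
  | .zeroPlus => ∀ x : M, plusM M (zeroM M) x = x
  | .existsNeg => ∀ x : M, ∃ y : M, plusM M y x = zeroM M
  | .scalPlus q => ∀ x y : M, scalM M q (plusM M x y) = plusM M (scalM M q x) (scalM M q y)
  | .plusScal q r => ∀ x : M, scalM M (q + r) x = plusM M (scalM M q x) (scalM M r x)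
  | .mulScal q r => ∀ x : M, scalM M (q * r) x = scalM M q (scalM M r x)
  | .oneScal => ∀ x : M, scalM M 1 x = x

theorem VSAxiom.realize_iff (ax : VSAxiom) : (M ⊨ ax.toSentence) ↔ ax.toProp M := by
  cases ax <;>
    simp [VSAxiom.toSentence, VSAxiom.toProp, Sentence.Realize, Formula.Realize, Fin.snoc]

variable [hM : M ⊨ Tt]

theorem VSAxiom.toProp_of_model (ax : VSAxiom) : ax.toProp M :=
  (ax.realize_iff M).1 (Theory.realize_sentence_of_mem Tt (Or.inl (Or.inr ⟨ax, rfl⟩)))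

/-- The additive group of a model of `T_t`. -/
@[reducible] noncomputable def modelAddCommGroup : AddCommGroup M :=
  letI : Add M := ⟨plusM M⟩
  letI : Zero M := ⟨zeroM M⟩
  letI : Neg M := ⟨fun x => (VSAxiom.toProp_of_model M .existsNeg x).choose⟩
  { AddGroup.ofLeftAxioms (G := M) (VSAxiom.toProp_of_model M .plusAssoc)
      (VSAxiom.toProp_of_model M .zeroPlus)
      (fun x => (VSAxiom.toProp_of_model M .existsNeg x).choose_spec) with
    add_comm := VSAxiom.toProp_of_model M .plusComm }

/-- The `ℚ(t)`-vector space structure of a model of `T_t`, with scalar multiplication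
`q • x = λ_q(x)`. -/
@[reducible] noncomputable def modelModule :
    letI := modelAddCommGroup M
    Module (RatFunc ℚ) M :=
  letI := modelAddCommGroup M
  letI : SMul (RatFunc ℚ) M := ⟨scalM M⟩
  Module.ofMinimalAxioms (fun q x y => VSAxiom.toProp_of_model M (.scalPlus q) x y)
    (fun q r x => VSAxiom.toProp_of_model M (.plusScal q r) x)
    (fun q r x => VSAxiom.toProp_of_model M (.mulScal q r) x)
    (VSAxiom.toProp_of_model M .oneScal)

/-- The `ℚ(t)`-linear span of a subset of a model of `T_t`. -/
noncomputable def linSpan (Z : Set M) : Set M :=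
  letI := modelAddCommGroup M
  letI := modelModule M
  (Submodule.span (RatFunc ℚ) Z : Set M)

end Model

end RatVS

namespace RatVS

open FirstOrder FirstOrder.Language

/-! ### Signs of affine functions and elimination of rational variables. -/

section Elimination

open SignType

/-! The truth of a formula depends only on the signs of finitely many affine functions over ℚ(t)
(`IsDenseModel.exists_determining`). This is quantifier elimination; the crux is one variable `y`
(`DenseScalars.exists_elim`). Scalars such as `t` do not respect the order, so inequalities cannot
be solved for `y`. Instead the coefficients are written in a ℚ-independent tuple `r`. If a
nonconstant function vanishes at `y`, then `y` is determined and can be substituted. Otherwise, by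
density, the tuple `r j • y` is as good as a tuple of free variables with rational coefficients, and
these are eliminated as in any divisible ordered group.

If `d` lies outside the span of `Z ∪ {1}`, no nonconstant affine function over that span vanishes at
`d`. Density then moves `d` without changing finitely many signs, so `{d}` is not definable over
`Z`. Conversely, the span is the substructure generated by `Z`, whose elements are values of terms.
Exchange is then Steinitz exchange for spans. -/

theorem sign_eq_sign_iff_pos_neg {N : Type*} [Zero N] [LinearOrder N] {a b : N} :
    sign a = sign b ↔ (0 < a ↔ 0 < b) ∧ (a < 0 ↔ b < 0) := by
  rcases lt_trichotomy a 0 with ha | rfl | ha <;> rcases lt_trichotomy b 0 with hb | rfl | hb <;>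
    simp [*, le_of_lt, sign_pos, sign_neg]
  all_goals exact iff_of_false (lt_asymm ‹_›) (lt_asymm ‹_›)

variable {M : Type*} [AddCommGroup M] [LinearOrder M] [IsOrderedAddMonoid M]

theorem sign_sub_eq_sign_sub_iff {a b a' b' : M} :
    sign (a - b) = sign (a' - b') ↔ (b < a ↔ b' < a') ∧ (a < b ↔ a' < b') := by
  simp [sign_eq_sign_iff_pos_neg]

/-- Finite linear orders extend: if `e` and `e'` have the same order type, any cut of `e` realised
by `z` is matched by a cut of `e'`. -/
theorem exists_sign_sub_eq {ι : Type*} [Nontrivial M] [DenselyOrdered M] (s : Finset ι) (e e' : ι → M)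
    (h : ∀ i ∈ s, ∀ j ∈ s, sign (e i - e j) = sign (e' i - e' j)) (z : M) :
    ∃ z', ∀ i ∈ s, sign (z - e i) = sign (z' - e' i) := by
  classical
  by_cases hz : ∃ i ∈ s, z = e i
  · obtain ⟨i, hi, rfl⟩ := hz
    exact ⟨e' i, fun j hj => h i hi j hj⟩
  push Not at hz
  -- Either finset may be empty: a nontrivial ordered group has no endpoints.
  obtain ⟨z', h1, h2⟩ := Order.exists_between_finsets ((s.filter fun i => e i < z).image e')
    ((s.filter fun i => z < e i).image e') (by
      simp only [Finset.mem_image, Finset.mem_filter]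
      rintro _ ⟨i, ⟨hi, hiz⟩, rfl⟩ _ ⟨j, ⟨hj, hjz⟩, rfl⟩
      exact ((sign_sub_eq_sign_sub_iff.1 (h i hi j hj)).2).1 (hiz.trans hjz))
  refine ⟨z', fun i hi => ?_⟩
  rcases lt_or_gt_of_ne (hz i hi) with hlt | hlt
  · have := h2 (e' i) (Finset.mem_image_of_mem _ (by simp [hi, hlt]))
    rw [sign_neg (by simpa), sign_neg (by simpa)]
  · have := h1 (e' i) (Finset.mem_image_of_mem _ (by simp [hi, hlt]))
    rw [sign_pos (by simpa), sign_pos (by simpa)]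

variable [Module ℚ M]

/-- Clearing the denominator reduces this to positivity of positive integer multiples. -/
instance posSMulStrictMono_rat : PosSMulStrictMono ℚ M := by
  refine ⟨fun n hn y z hyz => ?_⟩
  rw [← sub_pos, ← smul_sub]
  have hx := sub_pos.2 hyz
  set x := z - y
  by_contra! h
  have h1 : n.den • n • x ≤ 0 := nsmul_nonpos h _
  have h2 : n.den • n • x = n.num • x := by
    rw [← Nat.cast_smul_eq_nsmul ℚ, ← Int.cast_smul_eq_zsmul ℚ, smul_smul, Rat.den_mul_eq_num]
  exact (zsmul_pos hx (Rat.num_pos.2 hn)).not_ge (h2 ▸ h1)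

theorem sign_rat_smul (n : ℚ) (x : M) : sign (n • x) = sign n * sign x := by
  rcases lt_trichotomy n 0 with hn | rfl | hn <;> rcases lt_trichotomy x 0 with hx | rfl | hx <;>
    simp [sign_pos, sign_neg, smul_pos_of_neg_of_neg, smul_neg_of_pos_of_neg,
      smul_neg_of_neg_of_pos, *]

theorem exists_pos_forall_sign_add_eq {m : ℕ} (a : M) (ha : a ≠ 0) (n : Fin m → ℚ) :
    ∃ ε : M, 0 < ε ∧ ∀ w : Fin m → M, (∀ j, 0 < w j) → (∀ j, w j < ε) →
      sign (a + ∑ j, n j • w j) = sign a := by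
  have hN : 0 < 1 + ∑ j, |n j| := by positivity
  have ha' : 0 < |a| := abs_pos.2 ha
  -- With this `ε` the perturbation is at most `(∑ |n j|) • ε < |a|`; the summand 1 keeps the
  -- inequality strict and the divisor nonzero.
  refine ⟨(1 + ∑ j, |n j|)⁻¹ • |a|, smul_pos (inv_pos.2 hN) ha', fun w h0 h1 => ?_⟩
  set ε := (1 + ∑ j, |n j|)⁻¹ • |a| with hε
  have hε0 : 0 < ε := smul_pos (inv_pos.2 hN) ha'
  have hb : |∑ j, n j • w j| < |a| := by
    calc |∑ j, n j • w j| ≤ ∑ j, |n j • w j| := Finset.abs_sum_le_sum_abs _ _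
      _ ≤ ∑ j, |n j| • ε := Finset.sum_le_sum fun j _ => by
          rw [abs_smul, abs_of_pos (h0 j)]
          exact smul_le_smul_of_nonneg_left (h1 j).le (abs_nonneg _)
      _ = (∑ j, |n j|) • ε := (Finset.sum_smul ..).symm
      _ < (1 + ∑ j, |n j|) • ε := by rw [add_smul, one_smul]; simpa
      _ = |a| := smul_inv_smul₀ hN.ne' _
  rcases lt_or_gt_of_ne ha with h | h
  · rw [abs_of_neg h, abs_lt] at hb
    rw [sign_neg h, sign_neg (by simpa using add_lt_add_right hb.2 a)]
  · rw [abs_of_pos h, abs_lt] at hb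
    rw [sign_pos h, sign_pos (by simpa using add_lt_add_right hb.1 a)]

variable [Nontrivial M] [DenselyOrdered M]

/-- Elimination of one rational variable. -/
theorem exists_elim_rat {U : Type*} [AddCommGroup U] [Module ℚ U] (F : Finset (U × ℚ)) :
    ∃ G : Finset U, ∀ e e' : U →ₗ[ℚ] M, (∀ u ∈ G, sign (e u) = sign (e' u)) →
      ∀ z, ∃ z', ∀ p ∈ F, sign (e p.1 + p.2 • z) = sign (e' p.1 + p.2 • z') := by
  classical
  -- Constant terms, and differences of the roots `-(p.2⁻¹ • p.1)`. A zero coefficient gives the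
  -- spurious root 0, which is harmless.
  refine ⟨F.image Prod.fst ∪ (F ×ˢ F).image fun p => p.2.2⁻¹ • p.2.1 - p.1.2⁻¹ • p.1.1,
    fun e e' h z => ?_⟩
  obtain ⟨z', hz'⟩ := exists_sign_sub_eq F (fun p => -(p.2⁻¹ • e p.1)) (fun p => -(p.2⁻¹ • e' p.1))
    (fun i hi j hj => by
      have := h (j.2⁻¹ • j.1 - i.2⁻¹ • i.1) (Finset.mem_union_right _
        (Finset.mem_image.2 ⟨(i, j), by simp [hi, hj], rfl⟩))
      simp only [map_sub, map_smul] at this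
      convert this using 2 <;> abel) z
  refine ⟨z', fun p hp => ?_⟩
  by_cases hn : p.2 = 0
  · simpa [hn] using h p.1 (Finset.mem_union_left _ (Finset.mem_image_of_mem _ hp))
  · have key : ∀ (x w : M), x + p.2 • w = p.2 • (w - -(p.2⁻¹ • x)) := fun x w => by
      rw [sub_neg_eq_add, smul_add, smul_inv_smul₀ hn, add_comm]
    rw [key, key, sign_rat_smul, sign_rat_smul, hz' p hp]

/-- Elimination of finitely many rational variables. -/
theorem exists_elim_rat_fin (m : ℕ) : ∀ {U : Type*} [AddCommGroup U] [Module ℚ U]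
    (F : Finset (U × (Fin m → ℚ))),
    ∃ G : Finset U, ∀ e e' : U →ₗ[ℚ] M, (∀ u ∈ G, sign (e u) = sign (e' u)) →
      ∀ z : Fin m → M, ∃ z' : Fin m → M, ∀ p ∈ F,
        sign (e p.1 + ∑ j, p.2 j • z j) = sign (e' p.1 + ∑ j, p.2 j • z' j) := by
  classical
  induction m with
  | zero =>
    intro U _ _ F
    exact ⟨F.image Prod.fst, fun e e' h z => ⟨z, fun p hp => by
      simpa using h p.1 (Finset.mem_image_of_mem _ hp)⟩⟩
  | succ m ih =>
    intro U _ _ F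
    -- The factor ℚ carries the coefficient of the first variable, treated as a parameter while the
    -- others are eliminated.
    obtain ⟨G₁, hG₁⟩ := ih (U := U × ℚ) (F.image fun p => ((p.1, p.2 0), Fin.tail p.2))
    obtain ⟨G, hG⟩ := exists_elim_rat (M := M) G₁
    refine ⟨G, fun e e' h z => ?_⟩
    obtain ⟨z₀, hz₀⟩ := hG e e' h (z 0)
    obtain ⟨z', hz'⟩ := hG₁ (e.coprod (LinearMap.toSpanSingleton ℚ M (z 0)))
      (e'.coprod (LinearMap.toSpanSingleton ℚ M z₀)) (fun u hu => by simpa using hz₀ u hu)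
      (Fin.tail z)
    refine ⟨Fin.cons z₀ z', fun p hp => ?_⟩
    have := hz' _ (Finset.mem_image_of_mem _ hp)
    simpa [Fin.sum_univ_succ, Fin.tail, add_assoc] using this

/-! ### Dense scalars and elimination of a variable over the field. -/

variable {K : Type*} [Field K] [Module K M]

variable (M K) in
/-- Multiplication by any `ℚ`-linearly independent tuple of scalars has dense image. -/
def DenseScalars [Module ℚ K] : Prop :=
  ∀ (m : ℕ) (r : Fin m → K), LinearIndependent ℚ r → ∀ a b : Fin m → M, (∀ i, a i < b i) →
    ∃ x : M, ∀ i, a i < r i • x ∧ r i • x < b i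

/-- Nonzero values keep their sign on a small box with lower corner `z`, and density puts some `r j
• y` in that box. -/
theorem DenseScalars.exists_sign_eq [Module ℚ K] (hD : DenseScalars M K) {m : ℕ} {r : Fin m → K}
    (hr : LinearIndependent ℚ r) (z : Fin m → M) (F : Finset (M × (Fin m → ℚ)))
    (hF : ∀ p ∈ F, p.1 + ∑ j, p.2 j • z j ≠ 0) :
    ∃ y : M, (∀ j, z j < r j • y) ∧ ∀ p ∈ F,
      sign (p.1 + ∑ j, p.2 j • r j • y) = sign (p.1 + ∑ j, p.2 j • z j) := by
  classical
  have h := fun p : F => exists_pos_forall_sign_add_eq _ (hF p p.2) p.1.2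
  choose ε hε0 hε using h
  obtain ⟨δ, hδ0, hδ⟩ := Order.exists_between_finsets {(0 : M)} (Finset.univ.image ε)
    (by simpa using fun _ a b h e => e ▸ hε0 ⟨(a, b), h⟩)
  have hδ0 : 0 < δ := hδ0 0 (by simp)
  obtain ⟨y, hy⟩ := hD m r hr z (fun j => z j + δ) (fun j => by simpa)
  refine ⟨y, fun j => (hy j).1, fun p hp => ?_⟩
  rw [← hε ⟨p, hp⟩ (fun j => r j • y - z j) (fun j => by simpa using (hy j).1)
    (fun j => (sub_lt_iff_lt_add'.2 (hy j).2).trans (hδ _ (by simp)))]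
  simp [smul_sub]

variable [Algebra ℚ K]

/-- Linear coordinates, over `ℚ`, on the span of finitely many scalars. -/
theorem exists_linearIndependent_coords (s : Finset K) :
    ∃ (m : ℕ) (r : Fin m → K) (c : K → Fin m → ℚ), LinearIndependent ℚ r ∧ c 0 = 0 ∧
      ∀ q ∈ s, q = ∑ j, c q j • r j := by
  classical
  let V := Submodule.span ℚ (s : Set K)
  have : FiniteDimensional ℚ V := FiniteDimensional.span_finset ℚ s
  let b := Module.finBasis ℚ V
  refine ⟨_, fun j => (b j : K), fun q => if h : q ∈ V then b.repr ⟨q, h⟩ else 0,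
    b.linearIndependent.map' V.subtype (by simp), ?_, fun q hq => ?_⟩
  · have h0 : (0 : K) ∈ V := V.zero_mem
    have h0' : (⟨0, h0⟩ : V) = 0 := rfl
    ext j
    simp [h0, h0']
  · have hq' : q ∈ V := Submodule.subset_span hq
    have := congrArg V.subtype (b.sum_repr ⟨q, hq'⟩)
    simp only [dif_pos hq']
    rw [map_sum] at this
    exact this.symm

/-- Any point avoiding the zeros of finitely many nonconstant affine functions can be moved without
changing the signs of these functions. -/
theorem DenseScalars.exists_ne_sign_eq (hD : DenseScalars M K) (d : M) (F : Finset (M × K))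
    (hF : ∀ p ∈ F, p.2 ≠ 0 → p.1 + p.2 • d ≠ 0) :
    ∃ d', d' ≠ d ∧ ∀ p ∈ F, sign (p.1 + p.2 • d') = sign (p.1 + p.2 • d) := by
  classical
  -- Inserting 1 forces `r` to be nonempty, so the strict inequality `r 0 • d < r 0 • y` excludes `y
  -- = d`.
  obtain ⟨m, r, c, hr, -, hc⟩ :=
    exists_linearIndependent_coords (insert (1 : K) (F.image Prod.snd))
  have hc' : ∀ p ∈ F, ∀ y : M, p.2 • y = ∑ j, c p.2 j • r j • y := fun p hp y => by
    conv_lhs => rw [hc p.2 (by simpa using Or.inr ⟨_, hp⟩), Finset.sum_smul]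
    simp [smul_assoc]
  obtain ⟨y, hy, hF'⟩ := hD.exists_sign_eq hr (fun j => r j • d)
    ((F.filter fun p => p.2 ≠ 0).image fun p => (p.1, c p.2)) (by
      simp only [Finset.mem_image, Finset.mem_filter]
      rintro _ ⟨p, ⟨hp, hp0⟩, rfl⟩
      simpa only [← hc' p hp] using hF p hp hp0)
  refine ⟨y, ?_, fun p hp => ?_⟩
  · rintro rfl
    rcases m with _ | m
    · simpa using hc 1 (by simp)
    · exact lt_irrefl _ (hy 0)
  · by_cases hp0 : p.2 = 0
    · simp [hp0]
    · simpa only [← hc' p hp] using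
        hF' (p.1, c p.2) (Finset.mem_image_of_mem _ (Finset.mem_filter.2 ⟨hp, hp0⟩))

/-- Elimination of one variable over `K`. -/
theorem DenseScalars.exists_elim (hD : DenseScalars M K) {W : Type*} [AddCommGroup W] [Module K W]
    (F : Finset (W × K)) :
    ∃ G : Finset W, ∀ e e' : W →ₗ[K] M, (∀ u ∈ G, sign (e u) = sign (e' u)) →
      ∀ y, ∃ y', ∀ p ∈ F, sign (e p.1 + p.2 • y) = sign (e' p.1 + p.2 • y') := by
  classical
  let _ : Module ℚ W := Module.compHom W (algebraMap ℚ K)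
  obtain ⟨m, r, c, hr, hc0, hc⟩ := exists_linearIndependent_coords (F.image Prod.snd)
  have hc' : ∀ p ∈ F, ∀ y : M, p.2 • y = ∑ j, c p.2 j • r j • y := fun p hp y => by
    conv_lhs => rw [hc p.2 (Finset.mem_image_of_mem _ hp), Finset.sum_smul]
    simp [smul_assoc]
  obtain ⟨G, hG⟩ := exists_elim_rat_fin (M := M) m (F.image fun p => (p.1, c p.2))
  -- The second set holds the values of each function at the root of each other one, for the case
  -- where `y` is a root.
  refine ⟨G ∪ (F ×ˢ F).image fun p => p.2.1 + p.2.2 • -(p.1.2⁻¹ • p.1.1), fun e e' h y => ?_⟩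
  by_cases hy : ∃ p ∈ F, p.2 ≠ 0 ∧ e p.1 + p.2 • y = 0
  · obtain ⟨p, hp, hp0, hpy⟩ := hy
    refine ⟨-(p.2⁻¹ • e' p.1), fun q hq => ?_⟩
    have hy : y = -(p.2⁻¹ • e p.1) := by
      rw [eq_neg_of_add_eq_zero_left hpy, smul_neg, neg_neg, inv_smul_smul₀ hp0]
    have := h _ (Finset.mem_union_right _ (Finset.mem_image.2
      ⟨(p, q), Finset.mem_product.2 ⟨hp, hq⟩, rfl⟩))
    simpa only [hy, map_add, map_smul, map_neg] using this
  · push Not at hy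
    obtain ⟨z', hz'⟩ := hG (e.restrictScalars ℚ) (e'.restrictScalars ℚ)
      (fun u hu => h u (Finset.mem_union_left _ hu)) (fun j => r j • y)
    have hz : ∀ p ∈ F, sign (e p.1 + p.2 • y) = sign (e' p.1 + ∑ j, c p.2 j • z' j) :=
      fun p hp => by
        simpa only [← hc' p hp, LinearMap.restrictScalars_apply] using
          hz' (p.1, c p.2) (Finset.mem_image.2 ⟨p, hp, rfl⟩)
    -- `z'` need not be of the form `r j • y'`; it is replaced by such a tuple. Constant functions
    -- are left out since they may vanish.
    obtain ⟨y', -, hy'⟩ := hD.exists_sign_eq hr z'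
      ((F.filter fun p => p.2 ≠ 0).image fun p => (e' p.1, c p.2)) (by
        simp only [Finset.mem_image, Finset.mem_filter]
        rintro _ ⟨p, ⟨hp, hp0⟩, rfl⟩
        rw [← sign_ne_zero, ← hz p hp, sign_ne_zero]
        exact hy p hp hp0)
    refine ⟨y', fun p hp => ?_⟩
    rw [hz p hp]
    by_cases hp0 : p.2 = 0
    · simp [hp0, hc0]
    · simpa only [← hc' p hp] using
        (hy' (e' p.1, c p.2) (Finset.mem_image.2 ⟨p, Finset.mem_filter.2 ⟨hp, hp0⟩, rfl⟩)).symm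

end Elimination

/-! ### From formulas to affine functions, and definable closure as span. -/

section DefinableClosure

open SignType

variable {M : Type*} [Lt.Structure M]

theorem funMap_plusS (w : Fin 2 → M) : Structure.funMap plusS w = plusM M (w 0) (w 1) :=
  congrArg _ (List.ofFn_inj.1 rfl)

theorem funMap_scalS (q : RatFunc ℚ) (w : Fin 1 → M) :
    Structure.funMap (scalS q) w = scalM M q (w 0) :=
  congrArg _ (List.ofFn_inj.1 rfl)

theorem funMap_zeroS (w : Fin 0 → M) :
    Structure.funMap (L := Lt) (n := 0) VSFunc.zero w = zeroM M :=
  congrArg _ (Subsingleton.elim _ _)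

theorem funMap_oneS (w : Fin 0 → M) :
    Structure.funMap (L := Lt) (n := 0) VSFunc.one w = oneM M :=
  congrArg _ (Subsingleton.elim _ _)

theorem relMap_ltS (w : Fin 2 → M) : Structure.RelMap ltS w ↔ ltM M (w 0) (w 1) :=
  iff_of_eq (congrArg _ (List.ofFn_inj.1 rfl))

theorem closure_subset_dcl (Z : Set M) : (Substructure.closure Lt Z : Set M) ⊆ dcl Lt Z := by
  intro d hd
  obtain ⟨t, ht⟩ := Substructure.mem_closure_iff_exists_term.1 hd
  refine Set.definable_iff_exists_formula_sum.2
    ⟨(Term.var (Sum.inr 0)).equal (t.relabel Sum.inl), ?_⟩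
  ext x
  simp [Term.realize_relabel, ht]

variable [AddCommGroup M] [Module (RatFunc ℚ) M]

/-- The value at `v` of the affine function with the given coefficients. -/
noncomputable def affEval {γ : Type*} (v : γ → M) :
    (Option γ →₀ RatFunc ℚ) →ₗ[RatFunc ℚ] M :=
  Finsupp.linearCombination (RatFunc ℚ) fun o => o.elim (oneM M) v

/-- Separating the last variable of an affine function. -/
noncomputable def splitLast (β : Type*) (n : ℕ) : (Option (β ⊕ Fin (n + 1)) →₀ RatFunc ℚ)
    →ₗ[RatFunc ℚ] (Option (β ⊕ Fin n) →₀ RatFunc ℚ) × RatFunc ℚ :=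
  Finsupp.linearCombination (RatFunc ℚ) fun o => match o with
    | none => (Finsupp.single none 1, 0)
    | some (Sum.inl b) => (Finsupp.single (some (Sum.inl b)) 1, 0)
    | some (Sum.inr i) =>
      Fin.lastCases (0, 1) (fun j => (Finsupp.single (some (Sum.inr j)) 1, 0)) i

theorem affEval_snoc {β : Type*} {n : ℕ} (v : β → M) (xs : Fin n → M) (y : M)
    (u : Option (β ⊕ Fin (n + 1)) →₀ RatFunc ℚ) :
    affEval (Sum.elim v (Fin.snoc xs y : Fin (n + 1) → M)) u =
      affEval (Sum.elim v xs) (splitLast β n u).1 + (splitLast β n u).2 • y := by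
  suffices affEval (Sum.elim v (Fin.snoc xs y : Fin (n + 1) → M)) =
      (affEval (Sum.elim v xs)).coprod (LinearMap.toSpanSingleton (RatFunc ℚ) M y) ∘ₗ
        splitLast β n from by
    rw [this]; simp
  refine Finsupp.lhom_ext' fun o => LinearMap.ext_ring ?_
  rcases o with _ | b | i
  · simp [affEval, splitLast]
  · simp [affEval, splitLast]
  · refine Fin.lastCases ?_ (fun j => ?_) i <;> simp [affEval, splitLast]

/-- With the parameters fixed, everything but the one free variable collapses into a constant from
the span. -/
theorem exists_affEval_eq_add_smul (Z : Set M)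
    (u : Option ((Z ⊕ Fin 1) ⊕ Fin 0) →₀ RatFunc ℚ) :
    ∃ p : M × RatFunc ℚ, p.1 ∈ Submodule.span (RatFunc ℚ) (Z ∪ {oneM M}) ∧
      ∀ (x : Fin 1 → M) (xs : Fin 0 → M),
        affEval (Sum.elim (Sum.elim ((↑) : Z → M) x) xs) u = p.1 + p.2 • x 0 := by
  induction u using Finsupp.induction_linear with
  | zero => exact ⟨0, by simp, by simp⟩
  | add u u' ih ih' =>
    obtain ⟨p, hp, hp'⟩ := ih
    obtain ⟨q, hq, hq'⟩ := ih'
    refine ⟨p + q, add_mem hp hq, fun x xs => ?_⟩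
    rw [map_add, hp', hq', Prod.fst_add, Prod.snd_add, add_smul]
    abel
  | single o q =>
    rcases o with _ | (z | i) | i
    · exact ⟨(q • oneM M, 0), Submodule.smul_mem _ _ (Submodule.subset_span (by simp)),
        fun x xs => by simp [affEval]⟩
    · exact ⟨(q • (z : M), 0), Submodule.smul_mem _ _ (Submodule.subset_span (by simp)),
        fun x xs => by simp [affEval]⟩
    · exact ⟨(0, q), zero_mem _, fun x xs => by simp [affEval, Subsingleton.elim i 0]⟩
    · exact i.elim0

variable [LinearOrder M]

variable (M) in
/-- The symbols of `Lt` are interpreted in `M` by the ordered `ℚ(t)`-vector space structure of `M`,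
and the multiplications by scalars have dense images. -/
structure IsDenseModel : Prop where
  plus : ∀ x y : M, plusM M x y = x + y
  zero : zeroM M = 0
  scal : ∀ (q : RatFunc ℚ) (x : M), scalM M q x = q • x
  lt : ∀ x y : M, ltM M x y ↔ x < y
  dense : DenseScalars M (RatFunc ℚ)

theorem IsDenseModel.exists_realize_eq_affEval (h : IsDenseModel M) {γ : Type*} (t : Lt.Term γ) :
    ∃ u : Option γ →₀ RatFunc ℚ, ∀ v : γ → M, t.realize v = affEval v u := by
  induction t with
  | var a => exact ⟨Finsupp.single (some a) 1, fun v => by simp [affEval]⟩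
  | func f ts ih =>
    choose u hu using ih
    cases f with
    | plus => exact ⟨u 0 + u 1, fun v => (funMap_plusS fun i => (ts i).realize v).trans <| by
        rw [h.plus, hu, hu, map_add]⟩
    | zero => exact ⟨0, fun v => (funMap_zeroS fun i => (ts i).realize v).trans <| by
        rw [h.zero, map_zero]⟩
    | one => exact ⟨Finsupp.single none 1, fun v =>
        (funMap_oneS fun i => (ts i).realize v).trans <| by simp [affEval]⟩
    | scal q => exact ⟨q • u 0, fun v => (funMap_scalS q fun i => (ts i).realize v).trans <| by
        rw [h.scal, hu, map_smul]⟩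

theorem IsDenseModel.span_substructure (h : IsDenseModel M) (A : Lt.Substructure M) :
    (Submodule.span (RatFunc ℚ) ((A : Set M) ∪ {oneM M}) : Set M) = A := by
  refine Set.Subset.antisymm ?_ (Set.subset_union_left.trans Submodule.subset_span)
  intro x hx'
  have hx : x ∈ Submodule.span (RatFunc ℚ) ((A : Set M) ∪ {oneM M}) := hx'
  clear hx'
  have hone : oneM M ∈ A := by
    rw [← funMap_oneS default]; exact A.fun_mem _ _ fun i => i.elim0
  induction hx using Submodule.span_induction with
  | mem x hx =>
    rcases hx with hx | rfl
    exacts [hx, hone]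
  | zero =>
    rw [← h.zero, ← funMap_zeroS default]; exact A.fun_mem _ _ fun i => i.elim0
  | add x y _ _ hx hy =>
    rw [← h.plus]
    exact A.fun_mem plusS ![x, y] (Fin.forall_fin_two.2 ⟨hx, hy⟩)
  | smul q x _ hx =>
    rw [← h.scal]
    exact A.fun_mem (scalS q) ![x] (Fin.forall_fin_one.2 hx)

variable [IsOrderedAddMonoid M] [Module ℚ M] [Nontrivial M] [DenselyOrdered M]

/-- The truth of a formula is determined by the signs of finitely many affine functions. -/
theorem IsDenseModel.exists_determining (h : IsDenseModel M) {β : Type*} {n : ℕ}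
    (φ : Lt.BoundedFormula β n) :
    ∃ G : Finset (Option (β ⊕ Fin n) →₀ RatFunc ℚ), ∀ (v v' : β → M) (xs xs' : Fin n → M),
      (∀ u ∈ G, sign (affEval (Sum.elim v xs) u) = sign (affEval (Sum.elim v' xs') u)) →
        (φ.Realize v xs ↔ φ.Realize v' xs') := by
  classical
  induction φ with
  | falsum => exact ⟨∅, fun _ _ _ _ _ => Iff.rfl⟩
  | equal t₁ t₂ =>
    obtain ⟨u₁, h₁⟩ := h.exists_realize_eq_affEval t₁
    obtain ⟨u₂, h₂⟩ := h.exists_realize_eq_affEval t₂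
    refine ⟨{u₁ - u₂}, fun v v' xs xs' hG => ?_⟩
    have := hG _ (Finset.mem_singleton_self _)
    simp only [BoundedFormula.Realize, h₁, h₂]
    rw [← sub_eq_zero, ← map_sub, ← sign_eq_zero_iff, this, sign_eq_zero_iff, map_sub, sub_eq_zero]
  | rel R ts =>
    choose u hu using fun i => h.exists_realize_eq_affEval (ts i)
    cases R
    refine ⟨{u 0 - u 1}, fun v v' xs xs' hG => ?_⟩
    have := hG _ (Finset.mem_singleton_self _)
    rw [map_sub (affEval _), map_sub (affEval _), sign_sub_eq_sign_sub_iff] at this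
    simp only [BoundedFormula.Realize, hu]
    refine (relMap_ltS _).trans (Iff.trans ?_ (relMap_ltS _).symm)
    rw [h.lt, h.lt]
    exact this.2
  | imp φ ψ ihφ ihψ =>
    obtain ⟨G, hG⟩ := ihφ
    obtain ⟨H, hH⟩ := ihψ
    exact ⟨G ∪ H, fun v v' xs xs' hGH => imp_congr
      (hG v v' xs xs' fun u hu => hGH u (Finset.mem_union_left _ hu))
      (hH v v' xs xs' fun u hu => hGH u (Finset.mem_union_right _ hu))⟩
  | @all n φ ih =>
    obtain ⟨G, hG⟩ := ih
    obtain ⟨H, hH⟩ := h.dense.exists_elim (G.image (splitLast β n))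
    -- The sign condition is symmetric, so one implication suffices.
    have key : ∀ (v v' : β → M) (xs xs' : Fin n → M),
        (∀ u ∈ H, sign (affEval (Sum.elim v xs) u) = sign (affEval (Sum.elim v' xs') u)) →
          φ.all.Realize v' xs' → φ.all.Realize v xs := fun v v' xs xs' hs hφ y => by
      obtain ⟨y', hy'⟩ := hH _ _ hs y
      refine (hG v v' (Fin.snoc xs y) (Fin.snoc xs' y') fun u hu => ?_).2 (hφ y')
      rw [affEval_snoc, affEval_snoc]
      exact hy' _ (Finset.mem_image_of_mem _ hu)
    exact ⟨H, fun v v' xs xs' hs =>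
      ⟨key v' v xs' xs fun u hu => (hs u hu).symm, key v v' xs xs' hs⟩⟩

/-- A root of a nonconstant affine function over the span lies in the span, so a `d` outside can be
moved within the set defined by the formula. -/
theorem IsDenseModel.dcl_subset_span (h : IsDenseModel M) (Z : Set M) :
    dcl Lt Z ⊆ Submodule.span (RatFunc ℚ) (Z ∪ {oneM M}) := by
  classical
  intro d hd
  obtain ⟨φ, hφ⟩ := Set.definable_iff_exists_formula_sum.1 hd
  by_contra hdZ
  obtain ⟨G, hG⟩ := h.exists_determining φ
  choose p hp hpe using exists_affEval_eq_add_smul (M := M) Z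
  obtain ⟨d', hne, hd'⟩ := h.dense.exists_ne_sign_eq d (G.image p) (by
    simp only [Finset.mem_image]
    rintro _ ⟨u, -, rfl⟩ hq h0
    apply hdZ
    rw [← inv_smul_smul₀ hq d, eq_neg_of_add_eq_zero_right h0]
    exact Submodule.smul_mem _ _ (neg_mem (hp u)))
  have hmem : ∀ x : M, φ.Realize (Sum.elim ((↑) : Z → M) fun _ : Fin 1 => x) ↔ x = d := fun x =>
    (Set.ext_iff.1 hφ fun _ => x).symm
  refine hne ((hmem d').1 ((hG _ _ default default fun u hu => ?_).2 ((hmem d).2 rfl)))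
  rw [hpe, hpe]
  exact hd' _ (Finset.mem_image_of_mem _ hu)

theorem IsDenseModel.dcl_eq_span (h : IsDenseModel M) (Z : Set M) :
    dcl Lt Z = Submodule.span (RatFunc ℚ) (Z ∪ {oneM M}) := by
  refine (h.dcl_subset_span Z).antisymm (Set.Subset.trans ?_ (closure_subset_dcl Z))
  rw [← h.span_substructure (Substructure.closure Lt Z)]
  exact Submodule.span_mono (Set.union_subset_union_left _ Substructure.subset_closure)

theorem IsDenseModel.hasExchange (h : IsDenseModel M) : HasExchange Lt M := by
  rintro S a b ⟨hab, ha⟩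
  have hS : ∀ x : M, S ∪ {x} ∪ {oneM M} = insert x (S ∪ {oneM M}) := fun x => by
    rw [Set.union_right_comm, Set.union_singleton (a := x)]
  rw [h.dcl_eq_span, hS] at hab ⊢
  rw [h.dcl_eq_span] at ha
  exact mem_span_insert_exchange hab ha

end DefinableClosure

/-! ### Order and density axioms in a model of `Tt`. -/

section OrderedGroup

/-- The function symbol `+` of `Lbase`. -/
abbrev plusBS : Lbase.Functions 2 := BaseFunc.plus

/-- The constant symbol `0` of `Lbase`. -/
abbrev zeroBS : Lbase.Constants := BaseFunc.zero

/-- The constant symbol `1` of `Lbase`. -/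
abbrev oneBS : Lbase.Constants := BaseFunc.one

/-- The relation symbol `<` of `Lbase`. -/
abbrev ltBS : Lbase.Relations 2 := OrdRel.lt

/-- The axioms of nontrivial ordered groups used for models of `Tbase`. -/
inductive OrdAxiom : Type
  | irrefl
  | trans
  | total
  | addLt
  | onePos

/-- The first-order sentence expressing an axiom. -/
def OrdAxiom.toSentence : OrdAxiom → Lbase.Sentence
  | .irrefl => ∀' ∼(ltBS.boundedFormula₂ (&0) (&0))
  | .trans => ∀' ∀' ∀' (ltBS.boundedFormula₂ (&0) (&1) ⟹ ltBS.boundedFormula₂ (&1) (&2) ⟹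
      ltBS.boundedFormula₂ (&0) (&2))
  | .total => ∀' ∀' (∼(ltBS.boundedFormula₂ (&0) (&1)) ⟹ ∼((&0) =' (&1)) ⟹
      ltBS.boundedFormula₂ (&1) (&0))
  | .addLt => ∀' ∀' ∀' (ltBS.boundedFormula₂ (&0) (&1) ⟹
      ltBS.boundedFormula₂ (plusBS.apply₂ (&2) (&0)) (plusBS.apply₂ (&2) (&1)))
  | .onePos => ltBS.boundedFormula₂ zeroBS.term oneBS.term

/-- What an axiom says about a structure. -/
def OrdAxiom.toProp {N : Type*} (lt : N → N → Prop) (plus : N → N → N) (zero one : N) :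
    OrdAxiom → Prop
  | .irrefl => ∀ x, ¬ lt x x
  | .trans => ∀ x y z, lt x y → lt y z → lt x z
  | .total => ∀ x y, ¬ lt x y → ¬ x = y → lt y x
  | .addLt => ∀ x y z, lt x y → lt (plus z x) (plus z y)
  | .onePos => lt zero one

theorem OrdAxiom.realize_iff {N : Type*} [Lbase.Structure N] (ax : OrdAxiom) :
    (N ⊨ ax.toSentence) ↔ ax.toProp (N := N)
      (fun x y => Structure.RelMap ltBS ![x, y]) (fun x y => Structure.funMap plusBS ![x, y])
      zeroBS oneBS := by
  cases ax <;>
    simp [OrdAxiom.toSentence, OrdAxiom.toProp, Sentence.Realize, Formula.Realize, Fin.snoc,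
      BoundedFormula.realize_rel₂]

theorem OrdAxiom.mem_Tbase (ax : OrdAxiom) : ax.toSentence ∈ Tbase := by
  refine (ax.realize_iff (N := ℝ)).2 ?_
  cases ax with
  | irrefl => exact fun x => lt_irrefl x
  | trans => exact fun x y z => lt_trans
  | total => exact fun x y h h' => lt_of_le_of_ne (not_lt.1 h) (Ne.symm h')
  | addLt => exact fun x y z h => add_lt_add_right (α := ℝ) h z
  | onePos => exact zero_lt_one (α := ℝ)

variable (M : Type*) [Lt.Structure M] [hM : M ⊨ Tt]

/-- The axioms hold in ℝ, hence belong to `Tbase`, and pass to the reduct of `M`. -/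
theorem OrdAxiom.toProp_of_model (ax : OrdAxiom) :
    ax.toProp (ltM M) (plusM M) (zeroM M) (oneM M) := by
  let _ : Lbase.Structure M := baseHom.reduct M
  have h : M ⊨ baseHom.onSentence ax.toSentence :=
    Theory.realize_sentence_of_mem Tt (Or.inl (Or.inl ⟨_, ax.mem_Tbase, rfl⟩))
  exact ax.realize_iff.1 ((baseHom.realize_onSentence M _).1 h)

/-- The order of a model of `T_t`. -/
@[reducible] noncomputable def modelLinearOrder : LinearOrder M :=
  haveI : IsStrictOrder M (ltM M) :=
    { irrefl := OrdAxiom.toProp_of_model M .irrefl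
      trans := OrdAxiom.toProp_of_model M .trans }
  haveI : IsStrictTotalOrder M (ltM M) :=
    { trichotomous := fun x y h h' => by
        by_contra hne
        exact h' (OrdAxiom.toProp_of_model M .total x y h hne) }
  letI := Classical.decRel (ltM M)
  linearOrderOfSTO (ltM M)

theorem dense_of_model {m : ℕ} (q : Fin m → RatFunc ℚ) (hq : LinearIndependent ℚ q)
    (a b : Fin m → M) (h : ∀ i, ltM M (a i) (b i)) :
    ∃ x : M, ∀ i, ltM M (a i) (scalM M (q i) x) ∧ ltM M (scalM M (q i) x) (b i) := by
  have := Theory.realize_sentence_of_mem (M := M) Tt (Or.inr ⟨m, q, hq, rfl⟩ : denseSentence q ∈ Tt)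
  simp only [denseSentence, Sentence.Realize, Formula.realize_iAlls, Formula.realize_imp,
    Formula.realize_iInf, Formula.realize_iExs, Formula.realize_inf, realize_ltF,
    realize_scalT, Term.realize_var, Sum.elim_inl, Sum.elim_inr] at this
  obtain ⟨x, hx⟩ := this (Sum.elim a b) h
  exact ⟨x (), hx⟩

end OrderedGroup

end RatVS

theorem mainTheorem5 (M : Type*) [RatVS.Lt.Structure M] [M ⊨ RatVS.Tt] :
    RatVS.HasExchange RatVS.Lt M ∧
    (∀ Z : Set M, RatVS.dcl RatVS.Lt Z = RatVS.linSpan M (Z ∪ {RatVS.oneM M})) ∧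
    (∀ A : RatVS.Lt.Substructure M, RatVS.dcl RatVS.Lt (A : Set M) = (A : Set M)) := by
  let _ := RatVS.modelAddCommGroup M
  let _ := RatVS.modelModule M
  let _ := RatVS.modelLinearOrder M
  let _ : Module ℚ M := Module.compHom M (algebraMap ℚ (RatFunc ℚ))
  have : IsOrderedAddMonoid M :=
    { add_le_add_left := fun x y h z => by
        rcases h.eq_or_lt with rfl | h
        · exact le_rfl
        · rw [add_comm x, add_comm y]
          exact le_of_lt (α := M) (RatVS.OrdAxiom.toProp_of_model M .addLt x y z h) }
  have one_pos : (0 : M) < RatVS.oneM M := RatVS.OrdAxiom.toProp_of_model M .onePos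
  have : Nontrivial M := ⟨_, _, one_pos.ne⟩
  have dense : RatVS.DenseScalars M (RatFunc ℚ) := fun m r hr => RatVS.dense_of_model M r hr
  -- Density for the one-element tuple 1 is density of the order.
  have : DenselyOrdered M := ⟨fun a b hab => by
    obtain ⟨x, hx⟩ := dense 1 (fun _ => 1) (LinearIndependent.of_subsingleton 0 one_ne_zero)
      (fun _ => a) (fun _ => b) fun _ => hab
    exact ⟨_, hx 0⟩⟩
  have h : RatVS.IsDenseModel M :=
    ⟨fun _ _ => rfl, rfl, fun _ _ => rfl, fun _ _ => Iff.rfl, dense⟩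
  exact ⟨h.hasExchange, h.dcl_eq_span, fun A => (h.dcl_eq_span A).trans (h.span_substructure A)⟩
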